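/- Let $G$ be a finite group of order $n$. The reduced power graph $\mathcal{P}_R(G)$ is the undirected graph with vertex set $G$ in which two elements $x,y$ are adjacent if $\langle x\rangle\subsetneq\langle y\rangle$ or $\langle y\rangle\subsetneq\langle x\rangle$. In a connected graph $\Gamma$, a vertex $z$ strongly resolves $x$ and $y$ if some shortest path from $z$ to $x$ contains $y$, or some shortest path from $z$ to $y$ contains $x$; the strong metric dimension $\mathrm{sdim}(\Gamma)$ is the smallest cardinality of a set $S$ of vertices such that every two distinct vertices of $\Gamma$ are strongly resolved by some vertex in $S$. Let $\pi_e(G)$ be the set of orders of elements of $G$, and let $\Omega(m)$ be the number of prime factors of $m$ counted with multiplicity. Write $\mathbb{Z}_m$ for the cyclic group of order $m$ and, for $m\ge 2$, $Q_{4m}=\langle x,y : x^m=y^2,\ x^{2m}=y^4=e,\ y^{-1}xy=x^{-1}\rangle$ for the generalized quaternion group of order $4m$. Then $$ \mathrm{sdim}(\mathcal{P}_R(G))= \begin{cases} 2^k-k, & \text{if } G\cong \mathbb{Z}_{2^k} \text{ for some } k\ge 1;\\ 2^{t+2}-t-1, & \text{if } G\cong Q_{4\cdot 2^t} \text{ for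 some } t\ge 1;\\ n-\max\{\Omega(m): m\in \pi_e(G)\}-1, & \text{otherwise.} \end{cases} $$ -/

import Mathlib

/-- A vertex `z` strongly resolves `x` and `y` if there is a shortest path from `z` to `x`
containing `y`, or a shortest path from `z` to `y` containing `x`. (A walk whose length is the
distance between its endpoints is a shortest path.) -/
def SimpleGraph.StronglyResolves {V : Type*} (Γ : SimpleGraph V) (z x y : V) : Prop :=
  (∃ p : Γ.Walk z x, p.length = Γ.dist z x ∧ y ∈ p.support) ∨
    (∃ p : Γ.Walk z y, p.length = Γ.dist z y ∧ x ∈ p.support)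

/-- A set `S` of vertices is a strong resolving set if every pair of distinct vertices is
strongly resolved by some vertex in `S`. -/
def SimpleGraph.IsStrongResolvingSet {V : Type*} (Γ : SimpleGraph V) (S : Finset V) : Prop :=
  ∀ x y : V, x ≠ y → ∃ z ∈ S, Γ.StronglyResolves z x y

/-- The strong metric dimension: the smallest cardinality of a strong resolving set.
(In a finite connected graph the set of all vertices is a strong resolving set, so that the
infimum is a minimum.) -/
noncomputable def SimpleGraph.strongMetricDim {V : Type*} (Γ : SimpleGraph V) : ℕ :=
  sInf {c : ℕ | ∃ S : Finset V, Γ.IsStrongResolvingSet S ∧ S.card = c}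

/-- The reduced power graph of a group: the vertices are the elements of the group, and `x`, `y`
are adjacent if one of the cyclic subgroups they generate is properly contained in the other. -/
def reducedPowerGraph (G : Type*) [Group G] : SimpleGraph G where
  Adj x y := Subgroup.zpowers x < Subgroup.zpowers y ∨ Subgroup.zpowers y < Subgroup.zpowers x
  symm := ⟨fun _ _ h => Or.symm h⟩
  loopless := ⟨fun x h => h.elim (lt_irrefl (Subgroup.zpowers x)) (lt_irrefl (Subgroup.zpowers x))⟩

/-- The set of the orders of all elements of a group. -/
def elementOrders (G : Type*) [Group G] : Set ℕ :=
  Set.range (fun g : G => orderOf g)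

/-- The maximum of `Ω m` over all element orders `m`, where `Ω m` is the number of prime factors
of `m` counted with multiplicity. (For a finite group this is the supremum of a finite nonempty
set.) -/
noncomputable def maxOmegaElementOrder (G : Type*) [Group G] : ℕ :=
  sSup (ArithmeticFunction.cardFactors '' elementOrders G)

/-! The identity is adjacent to every other vertex, so distances are at most two. A third vertex
then strongly resolves `x` and `y` exactly when they are adjacent and it is adjacent to just one of
them. Hence `S` is strong resolving iff its complement is a clique without twins
(`isStrongResolvingSet_compl_iff`), and the dimension is `n` minus the largest size of such a
clique.

A clique is a chain of cyclic subgroups along which Ω of the order strictly grows, so it has at most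
max Ω + 1 elements; removing one prime at a time from a suitable order attains this. Adjacent twins
are always `1` and an involution `y` lying in every nontrivial cyclic subgroup. If such a `y`
exists, exactly one vertex is lost.

Such a group is a 2-group with a unique involution, hence cyclic or generalized quaternion
(`IsCommonInvolution.cyclic_or_quaternion`). There a normal cyclic subgroup of maximal order is
self-centralizing, and every element outside it inverts it and squares to `y`. -/

/-- A clique is twin-free if any two of its vertices are told apart by the adjacency to some third
vertex. -/
def SimpleGraph.IsTwinFreeClique {V : Type*} (Γ : SimpleGraph V) (T : Finset V) : Prop :=
  ∀ x ∈ T, ∀ y ∈ T, x ≠ y → Γ.Adj x y ∧ ∃ z, z ≠ x ∧ z ≠ y ∧ ¬(Γ.Adj z x ↔ Γ.Adj z y)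

/-! ### Strong metric dimension of a graph with a dominating vertex -/

namespace SimpleGraph

variable {V : Type*} {Γ : SimpleGraph V}

theorem exists_walk_length_le_two {c : V} (hc : ∀ v, v ≠ c → Γ.Adj c v) (x y : V) :
    ∃ p : Γ.Walk x y, p.length ≤ 2 := by
  by_cases hx : x = c
  · subst hx
    by_cases hy : y = x
    · subst hy
      exact ⟨Walk.nil, by simp⟩
    · exact ⟨Walk.cons (hc y hy) Walk.nil, by simp⟩
  · by_cases hy : y = c
    · subst hy
      exact ⟨Walk.cons (hc x hx).symm Walk.nil, by simp⟩
    · exact ⟨Walk.cons (hc x hx).symm (Walk.cons (hc y hy) Walk.nil), by simp⟩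

/-- A shortest path has length at most two, so an interior vertex can only be its midpoint. -/
theorem exists_geodesic_through_iff {c : V} (hc : ∀ v, v ≠ c → Γ.Adj c v) {x y z : V}
    (hxy : x ≠ y) (hzx : z ≠ x) (hzy : z ≠ y) :
    (∃ p : Γ.Walk z x, p.length = Γ.dist z x ∧ y ∈ p.support) ↔
      Γ.Adj x y ∧ Γ.Adj z y ∧ ¬Γ.Adj z x := by
  constructor
  · rintro ⟨p, hp, hy⟩
    obtain ⟨q, hq⟩ := exists_walk_length_le_two hc z x
    have h2 : p.length ≤ 2 := hp.trans_le ((dist_le q).trans hq)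
    cases p with
    | nil => exact absurd rfl hzx
    | cons h p =>
      cases p with
      | nil => simp [hzy.symm, hxy.symm] at hy
      | cons h' p =>
        cases p with
        | nil =>
          simp only [Walk.support_cons, Walk.support_nil, List.mem_cons, List.not_mem_nil, or_false,
            hzy.symm, hxy.symm, false_or] at hy
          subst hy
          refine ⟨h'.symm, h, fun hz => ?_⟩
          have := dist_le (Walk.cons hz Walk.nil)
          simp at hp this
          omega
        | cons h'' p =>
          simp at h2
  · rintro ⟨h1, h2, h3⟩
    let p : Γ.Walk z x := Walk.cons h2 (Walk.cons h1.symm Walk.nil)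
    refine ⟨p, le_antisymm ?_ (dist_le p), by simp [p]⟩
    have hr : Γ.Reachable z x := ⟨p⟩
    have h0 := hr.pos_dist_of_ne hzx
    have h4 : Γ.dist z x ≠ 1 := fun h => h3 (dist_eq_one_iff_adj.1 h)
    simp only [p, Walk.length_cons, Walk.length_nil]
    omega

theorem stronglyResolves_iff {c : V} (hc : ∀ v, v ≠ c → Γ.Adj c v) {x y z : V}
    (hxy : x ≠ y) (hzx : z ≠ x) (hzy : z ≠ y) :
    Γ.StronglyResolves z x y ↔ Γ.Adj x y ∧ ¬(Γ.Adj z x ↔ Γ.Adj z y) := by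
  unfold StronglyResolves
  rw [exists_geodesic_through_iff hc hxy hzx hzy, exists_geodesic_through_iff hc hxy.symm hzy hzx,
    Γ.adj_comm y x]
  tauto

theorem stronglyResolves_left {c : V} (hc : ∀ v, v ≠ c → Γ.Adj c v) (x y : V) :
    Γ.StronglyResolves x x y := by
  obtain ⟨q, -⟩ := exists_walk_length_le_two hc x y
  obtain ⟨p, hp⟩ := Reachable.exists_walk_length_eq_dist ⟨q⟩
  exact Or.inr ⟨p, hp, p.start_mem_support⟩

theorem stronglyResolves_right {c : V} (hc : ∀ v, v ≠ c → Γ.Adj c v) (x y : V) :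
    Γ.StronglyResolves y x y := by
  obtain ⟨q, -⟩ := exists_walk_length_le_two hc y x
  obtain ⟨p, hp⟩ := Reachable.exists_walk_length_eq_dist ⟨q⟩
  exact Or.inl ⟨p, hp, p.start_mem_support⟩

theorem isStrongResolvingSet_compl_iff [Fintype V] [DecidableEq V] {c : V}
    (hc : ∀ v, v ≠ c → Γ.Adj c v) (T : Finset V) :
    Γ.IsStrongResolvingSet Tᶜ ↔ Γ.IsTwinFreeClique T := by
  constructor
  · intro h x hx y hy hxy
    obtain ⟨z, hz, hr⟩ := h x y hxy
    rw [Finset.mem_compl] at hz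
    have hzx : z ≠ x := fun h => hz (h ▸ hx)
    have hzy : z ≠ y := fun h => hz (h ▸ hy)
    obtain ⟨h1, h2⟩ := (stronglyResolves_iff hc hxy hzx hzy).1 hr
    exact ⟨h1, z, hzx, hzy, h2⟩
  · intro h x y hxy
    by_cases hx : x ∈ T
    · by_cases hy : y ∈ T
      · obtain ⟨h1, z, hzx, hzy, h2⟩ := h x hx y hy hxy
        refine ⟨z, ?_, (stronglyResolves_iff hc hxy hzx hzy).2 ⟨h1, h2⟩⟩
        rw [Finset.mem_compl]
        intro hz
        -- A separating vertex inside the clique would be adjacent to both ends.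
        exact h2 ⟨fun _ => (h z hz y hy hzy).1, fun _ => (h z hz x hx hzx).1⟩
      · exact ⟨y, Finset.mem_compl.2 hy, stronglyResolves_right hc x y⟩
    · exact ⟨x, Finset.mem_compl.2 hx, stronglyResolves_left hc x y⟩

theorem strongMetricDim_add_eq_card [Finite V] {c : V} (hc : ∀ v, v ≠ c → Γ.Adj c v) {k : ℕ}
    (hk : ∃ T, Γ.IsTwinFreeClique T ∧ T.card = k)
    (hk' : ∀ T, Γ.IsTwinFreeClique T → T.card ≤ k) :
    Γ.strongMetricDim + k = Nat.card V := by
  classical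
  have := Fintype.ofFinite V
  rw [Nat.card_eq_fintype_card]
  obtain ⟨T, hT, rfl⟩ := hk
  have hmem : Tᶜ.card ∈ {c : ℕ | ∃ S : Finset V, Γ.IsStrongResolvingSet S ∧ S.card = c} :=
    ⟨Tᶜ, (isStrongResolvingSet_compl_iff hc T).2 hT, rfl⟩
  have hle : Γ.strongMetricDim ≤ Tᶜ.card := Nat.sInf_le hmem
  obtain ⟨S, hS, hcard⟩ := Nat.sInf_mem ⟨_, hmem⟩
  change S.card = Γ.strongMetricDim at hcard
  rw [← compl_compl S, isStrongResolvingSet_compl_iff hc] at hS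
  have h1 := hk' _ hS
  have h2 := Finset.card_add_card_compl S
  have h3 := Finset.card_add_card_compl T
  omega

end SimpleGraph

open ArithmeticFunction (cardFactors)

theorem cardFactors_lt_of_dvd {a b : ℕ} (hb : b ≠ 0) (hab : a ∣ b) (hne : a ≠ b) :
    cardFactors a < cardFactors b := by
  obtain ⟨c, rfl⟩ := hab
  have ha : a ≠ 0 := left_ne_zero_of_mul hb
  have hc : c ≠ 0 := right_ne_zero_of_mul hb
  have : c ≠ 1 := fun h => hne (by simp [h])
  rw [ArithmeticFunction.cardFactors_mul ha hc]
  have := ArithmeticFunction.cardFactors_pos_iff_one_lt.2 (by omega : 1 < c)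
  omega

/-! ### Cliques and twins in the reduced power graph -/

section Group

variable {G : Type*} [Group G]

theorem reducedPowerGraph_adj_one {x : G} (hx : x ≠ 1) : (reducedPowerGraph G).Adj 1 x := by
  left
  rw [Subgroup.zpowers_one_eq_bot, bot_lt_iff_ne_bot]
  simpa using hx

/-- An involution lying in every nontrivial cyclic subgroup. -/
def IsCommonInvolution (y : G) : Prop :=
  orderOf y = 2 ∧ ∀ x : G, x ≠ 1 → y ∈ Subgroup.zpowers x

theorem IsCommonInvolution.ne_one {y : G} (hy : IsCommonInvolution y) : y ≠ 1 := by
  rintro rfl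
  simpa using hy.1

theorem IsCommonInvolution.zpowers_le {y : G} (hy : IsCommonInvolution y) {x : G} (hx : x ≠ 1) :
    Subgroup.zpowers y ≤ Subgroup.zpowers x :=
  Subgroup.zpowers_le.2 (hy.2 x hx)

theorem eq_of_mem_zpowers_of_orderOf_eq_two {x y : G} (hx : orderOf x = 2) (hy : y ≠ 1)
    (h : y ∈ Subgroup.zpowers x) : y = x := by
  have hf : IsOfFinOrder x := orderOf_pos_iff.1 (by omega)
  obtain ⟨k, hk⟩ := (hf.mem_powers_iff_mem_zpowers.2 h)
  have hk' : x ^ (k % 2) = y := by rw [← hx, pow_mod_orderOf]; exact hk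
  obtain h0 | h1 := Nat.mod_two_eq_zero_or_one k
  · rw [h0, pow_zero] at hk'
    exact absurd hk'.symm hy
  · rw [h1, pow_one] at hk'
    exact hk'.symm

theorem IsCommonInvolution.eq_of_orderOf_eq_two {x y : G} (hy : IsCommonInvolution y)
    (hx : orderOf x = 2) : x = y := by
  have h1 : x ≠ 1 := by rintro rfl; simp at hx
  exact (eq_of_mem_zpowers_of_orderOf_eq_two hx hy.ne_one (hy.2 x h1)).symm

theorem cardFactors_orderOf_lt [Finite G] {x y : G}
    (h : Subgroup.zpowers x < Subgroup.zpowers y) :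
    cardFactors (orderOf x) < cardFactors (orderOf y) := by
  refine cardFactors_lt_of_dvd (orderOf_pos y).ne'
    (orderOf_dvd_of_mem_zpowers (Subgroup.zpowers_le.1 h.le)) fun he => h.ne ?_
  refine Subgroup.eq_of_le_of_card_ge h.le ?_
  rw [Nat.card_zpowers, Nat.card_zpowers, he]

theorem cardFactors_orderOf_ne [Finite G] {x y : G} (h : (reducedPowerGraph G).Adj x y) :
    cardFactors (orderOf x) ≠ cardFactors (orderOf y) := by
  rcases h with h | h
  · exact (cardFactors_orderOf_lt h).ne
  · exact (cardFactors_orderOf_lt h).ne'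

theorem IsCommonInvolution.zpowers_lt {y : G} (hy : IsCommonInvolution y) {x : G} (hx : x ≠ 1)
    (hxy : x ≠ y) : Subgroup.zpowers y < Subgroup.zpowers x := by
  refine lt_of_le_of_ne (hy.zpowers_le hx) fun h => hxy ?_
  exact eq_of_mem_zpowers_of_orderOf_eq_two hy.1 hx (h ▸ Subgroup.mem_zpowers x)

theorem bddAbove_cardFactors_elementOrders (G : Type*) [Group G] [Finite G] :
    BddAbove (cardFactors '' elementOrders G) :=
  ((Set.finite_range _).image _).bddAbove

theorem cardFactors_orderOf_le [Finite G] (x : G) :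
    cardFactors (orderOf x) ≤ maxOmegaElementOrder G :=
  le_csSup (bddAbove_cardFactors_elementOrders G) ⟨_, ⟨x, rfl⟩, rfl⟩

theorem exists_cardFactors_orderOf_eq (G : Type*) [Group G] [Finite G] :
    ∃ x : G, cardFactors (orderOf x) = maxOmegaElementOrder G := by
  have hne : (cardFactors '' elementOrders G).Nonempty := ⟨_, _, ⟨1, rfl⟩, rfl⟩
  obtain ⟨_, ⟨x, rfl⟩, hx⟩ := Nat.sSup_mem hne (bddAbove_cardFactors_elementOrders G)
  exact ⟨x, hx⟩

/-- The chain starts at `x` and passes to a `p`-th power, `p` a prime divisor of the current order,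
until it reaches `1`. Membership of `1` is recorded because it is erased when a common involution
exists. -/
theorem exists_clique_card_eq [Finite G] (x : G) :
    ∃ T : Finset G, (∀ a ∈ T, a ∈ Subgroup.zpowers x) ∧ 1 ∈ T ∧
      (∀ a ∈ T, ∀ b ∈ T, a ≠ b → (reducedPowerGraph G).Adj a b) ∧
      T.card = cardFactors (orderOf x) + 1 := by
  classical
  induction hm : orderOf x using Nat.strong_induction_on generalizing x with
  | _ m ih =>
    by_cases h1 : m = 1
    · rw [h1, orderOf_eq_one_iff] at hm
      subst hm
      refine ⟨{1}, ?_, by simp, ?_, ?_⟩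
      · simp
      · simp only [Finset.mem_singleton]
        rintro a rfl b rfl h
        exact absurd rfl h
      · simp [h1]
    · obtain ⟨p, hp, k, hk⟩ := Nat.exists_prime_and_dvd h1
      have hm0 : 0 < m := hm ▸ orderOf_pos x
      have hk0 : 0 < k := Nat.pos_of_ne_zero (by rintro rfl; simp at hk; omega)
      have hord : orderOf (x ^ p) = k := by
        rw [orderOf_pow_of_dvd hp.ne_zero (hm ▸ ⟨k, hk⟩), hm, hk, Nat.mul_div_cancel_left _ hp.pos]
      have hkm : k < m := by rw [hk]; exact lt_mul_of_one_lt_left hk0 hp.one_lt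
      obtain ⟨T, hT, hT1, hadj, hcard⟩ := ih k hkm (x ^ p) hord
      have hle : Subgroup.zpowers (x ^ p) ≤ Subgroup.zpowers x :=
        Subgroup.zpowers_le.2 (Subgroup.npow_mem_zpowers x p)
      have hlt : Subgroup.zpowers (x ^ p) < Subgroup.zpowers x := by
        refine lt_of_le_of_ne hle fun h => ?_
        have := congrArg (fun H : Subgroup G => Nat.card H) h
        simp only [Nat.card_zpowers] at this
        omega
      have hlt' : ∀ a ∈ T, Subgroup.zpowers a < Subgroup.zpowers x := fun a ha =>
        lt_of_le_of_lt (Subgroup.zpowers_le.2 (hT a ha)) hlt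
      refine ⟨insert x T, ?_, Finset.mem_insert_of_mem hT1, ?_, ?_⟩
      · intro a ha
        rcases Finset.mem_insert.1 ha with rfl | ha
        · exact Subgroup.mem_zpowers a
        · exact hle (hT a ha)
      · intro a ha b hb hab
        rcases Finset.mem_insert.1 ha with rfl | ha'
        · rcases Finset.mem_insert.1 hb with rfl | hb'
          · exact absurd rfl hab
          · exact Or.inr (hlt' b hb')
        · rcases Finset.mem_insert.1 hb with rfl | hb'
          · exact Or.inl (hlt' a ha')
          · exact hadj a ha' b hb' hab
      · rw [Finset.card_insert_of_notMem fun h => (hlt' x h).ne rfl, hcard, hk,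
          ArithmeticFunction.cardFactors_mul hp.ne_zero hk0.ne',
          ArithmeticFunction.cardFactors_apply_prime hp]
        omega

/-- `y⁻¹` generates the same subgroup as `y`, so it is adjacent to `x` but not to `y`; being no
separating vertex, it equals `y`. So `y` is an involution and `x = 1`, and whatever is adjacent to
`1` is adjacent to `y`. -/
theorem isCommonInvolution_of_twins [Finite G] {x y : G}
    (h : Subgroup.zpowers x < Subgroup.zpowers y)
    (htwin : ∀ z, z ≠ x → z ≠ y → ((reducedPowerGraph G).Adj z x ↔ (reducedPowerGraph G).Adj z y)) :
    x = 1 ∧ IsCommonInvolution y := by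
  have hxy : x ≠ y := by rintro rfl; exact h.ne rfl
  have hy1 : y ≠ 1 := by
    rintro rfl
    simp at h
  have hinv : y⁻¹ = y := by
    by_contra hne
    have hz : y⁻¹ ≠ x := by
      rintro rfl
      simp at h
    have h1 : (reducedPowerGraph G).Adj y⁻¹ x := Or.inr (by simpa using h)
    have h2 := (htwin _ hz hne).1 h1
    simp [reducedPowerGraph] at h2
  have hord : orderOf y = 2 := by
    refine orderOf_eq_prime ?_ hy1
    rw [sq]
    nth_rewrite 1 [← hinv]
    simp
  have hx1 : x = 1 := by
    by_contra hx1
    exact hxy (eq_of_mem_zpowers_of_orderOf_eq_two hord hx1 (Subgroup.zpowers_le.1 h.le))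
  refine ⟨hx1, hord, fun z hz => ?_⟩
  by_cases hzy : z = y
  · subst hzy; exact Subgroup.mem_zpowers z
  · subst hx1
    rcases (htwin z hz hzy).1 (reducedPowerGraph_adj_one hz).symm with h3 | h3
    · exact absurd (eq_of_mem_zpowers_of_orderOf_eq_two hord hz (Subgroup.zpowers_le.1 h3.le)) hzy
    · exact Subgroup.zpowers_le.1 h3.le

theorem isCommonInvolution_of_adj_twins [Finite G] {x y : G}
    (h : (reducedPowerGraph G).Adj x y)
    (htwin : ∀ z, z ≠ x → z ≠ y → ((reducedPowerGraph G).Adj z x ↔ (reducedPowerGraph G).Adj z y)) :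
    x = 1 ∧ IsCommonInvolution y ∨ y = 1 ∧ IsCommonInvolution x := by
  rcases h with h | h
  · exact Or.inl (isCommonInvolution_of_twins h htwin)
  · exact Or.inr (isCommonInvolution_of_twins h fun z h1 h2 => (htwin z h2 h1).symm)

/-- Ω of the order is injective on a clique. The set `s` is left free so that one value can be
removed from the range. -/
theorem card_le_of_isTwinFreeClique [Finite G] {T : Finset G}
    (hT : (reducedPowerGraph G).IsTwinFreeClique T) (s : Finset ℕ)
    (hs : ∀ x ∈ T, cardFactors (orderOf x) ∈ s) : T.card ≤ s.card := by
  refine Finset.card_le_card_of_injOn (fun x => cardFactors (orderOf x)) hs ?_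
  intro x hx y hy hxy
  by_contra hne
  exact cardFactors_orderOf_ne (hT x hx y hy hne).1 hxy

theorem strongMetricDim_of_not_exists_isCommonInvolution [Finite G]
    (h : ¬∃ y : G, IsCommonInvolution y) :
    (reducedPowerGraph G).strongMetricDim + (maxOmegaElementOrder G + 1) = Nat.card G := by
  refine SimpleGraph.strongMetricDim_add_eq_card (c := (1 : G))
    (fun v hv => reducedPowerGraph_adj_one hv) ?_ ?_
  · obtain ⟨x, hx⟩ := exists_cardFactors_orderOf_eq G
    obtain ⟨T, -, -, hadj, hcard⟩ := exists_clique_card_eq x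
    refine ⟨T, fun a ha b hb hab => ⟨hadj a ha b hb hab, ?_⟩, hcard.trans (by rw [hx])⟩
    by_contra! htwin
    rcases isCommonInvolution_of_adj_twins (hadj a ha b hb hab) htwin with h1 | h1
    · exact h ⟨_, h1.2⟩
    · exact h ⟨_, h1.2⟩
  · intro T hT
    refine (card_le_of_isTwinFreeClique hT (Finset.range (maxOmegaElementOrder G + 1)) ?_).trans_eq
      (Finset.card_range _)
    intro x _
    exact Finset.mem_range.2 (Nat.lt_succ_of_le (cardFactors_orderOf_le x))

theorem strongMetricDim_of_isCommonInvolution [Finite G] {y : G} (hy : IsCommonInvolution y) :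
    (reducedPowerGraph G).strongMetricDim + maxOmegaElementOrder G = Nat.card G := by
  classical
  have hy1 := hy.ne_one
  refine SimpleGraph.strongMetricDim_add_eq_card (c := (1 : G))
    (fun v hv => reducedPowerGraph_adj_one hv) ?_ ?_
  · obtain ⟨x, hx⟩ := exists_cardFactors_orderOf_eq G
    obtain ⟨T, -, h1, hadj, hcard⟩ := exists_clique_card_eq x
    refine ⟨T.erase 1, fun a ha b hb hab => ?_, ?_⟩
    · rw [Finset.mem_erase] at ha hb
      refine ⟨hadj a ha.2 b hb.2 hab, ?_⟩
      by_contra! htwin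
      rcases isCommonInvolution_of_adj_twins (hadj a ha.2 b hb.2 hab) htwin with h2 | h2
      · exact ha.1 h2.1
      · exact hb.1 h2.1
    · rw [Finset.card_erase_of_mem h1, hcard, hx, Nat.add_sub_cancel]
  · intro T hT
    -- `1` and `y` are adjacent twins. Whichever is missing removes a value of Ω: 0 occurs only at
    -- `1`, and 1 only at `y`, since all other elements generate subgroups properly containing that
    -- of `y`.
    have hnot : 1 ∉ T ∨ y ∉ T := by
      by_contra! hmem
      obtain ⟨-, z, hz1, hzy, hz⟩ := hT 1 hmem.1 y hmem.2 hy1.symm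
      exact hz ⟨fun _ => Or.inr (hy.zpowers_lt hz1 hzy),
        fun _ => (reducedPowerGraph_adj_one hz1).symm⟩
    have hle (x : G) := Finset.mem_range.2 (Nat.lt_succ_of_le (cardFactors_orderOf_le x))
    have hmax : 1 ≤ maxOmegaElementOrder G := by
      have := cardFactors_orderOf_le y
      rwa [hy.1, ArithmeticFunction.cardFactors_apply_prime Nat.prime_two] at this
    rcases hnot with hnot | hnot
    · refine (card_le_of_isTwinFreeClique hT
        ((Finset.range (maxOmegaElementOrder G + 1)).erase 0) ?_).trans_eq ?_
      · intro x hx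
        refine Finset.mem_erase.2 ⟨fun h0 => hnot ?_, hle x⟩
        rcases ArithmeticFunction.cardFactors_eq_zero_iff_eq_zero_or_one.1 h0 with h | h
        · exact absurd h (orderOf_pos x).ne'
        · exact orderOf_eq_one_iff.1 h ▸ hx
      · rw [Finset.card_erase_of_mem (by simp), Finset.card_range, Nat.add_sub_cancel]
    · refine (card_le_of_isTwinFreeClique hT
        ((Finset.range (maxOmegaElementOrder G + 1)).erase 1) ?_).trans_eq ?_
      · intro x hx
        refine Finset.mem_erase.2 ⟨fun h0 => ?_, hle x⟩
        have hxy : x ≠ y := fun h => hnot (h ▸ hx)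
        have hx1 : x ≠ 1 := by
          rintro rfl
          simp at h0
        have := cardFactors_orderOf_lt (hy.zpowers_lt hx1 hxy)
        rw [h0, hy.1, ArithmeticFunction.cardFactors_apply_prime Nat.prime_two] at this
        exact lt_irrefl _ this
      · rw [Finset.card_erase_of_mem (Finset.mem_range.2 (by omega)), Finset.card_range,
          Nat.add_sub_cancel]

end Group

/-! ### Classification of finite groups with a common involution -/

/-- Here `a` has order `2 ^ k`, `x` conjugates `a` to `a ^ u`, and `x ^ 2 = a ^ s`. The hypotheses
say that `x` commutes with `x ^ 2`, that it does not commute with `a`, and that no `a ^ i * x`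
squares to `1`. By Bézout the last means that gcd(1 + u, 2 ^ k) does not divide `s`. If `u` is 1 mod
4, this gcd divides 2 while `s` is even; so `u` is 3 mod 4, `2 ^ k` divides `2 * s`, and a gcd below
`2 ^ k` would divide `s`. -/
theorem two_pow_dvd_of_forall_not_dvd {k : ℕ} {u s : ℤ} (h1 : (2 : ℤ) ^ k ∣ s * (u - 1))
    (h2 : ¬(2 : ℤ) ^ k ∣ u - 1) (h3 : ∀ i : ℤ, ¬(2 : ℤ) ^ k ∣ i * (1 + u) + s) :
    (2 : ℤ) ^ k ∣ u + 1 ∧ (2 : ℤ) ^ k ∣ 2 * s := by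
  have hgcd : ¬((Int.gcd (1 + u) (2 ^ k) : ℕ) : ℤ) ∣ s := by
    rintro ⟨r, hr⟩
    rw [Int.gcd_eq_gcd_ab] at hr
    refine h3 (-(r * Int.gcdA (1 + u) (2 ^ k))) ⟨r * Int.gcdB (1 + u) (2 ^ k), ?_⟩
    rw [hr]
    ring
  have hcop {w : ℤ} (hw : ¬(2 : ℤ) ∣ w) : IsCoprime ((2 : ℤ) ^ k) w :=
    IsCoprime.pow_left ((Int.prime_two.coprime_iff_not_dvd).2 hw)
  have hdvd_left : ((Int.gcd (1 + u) (2 ^ k) : ℕ) : ℤ) ∣ 1 + u := Int.gcd_dvd_left ..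
  have hdvd_right : ((Int.gcd (1 + u) (2 ^ k) : ℕ) : ℤ) ∣ 2 ^ k := Int.gcd_dvd_right ..
  have hodd : (2 : ℤ) ∣ 1 + u := by
    by_contra h
    refine hgcd ?_
    rw [Int.isCoprime_iff_gcd_eq_one.1 (hcop h).symm, Nat.cast_one]
    exact one_dvd s
  have hu : u % 4 = 1 ∨ u % 4 = 3 := by omega
  rcases hu with hu | hu
  · exfalso
    have hs : (2 : ℤ) ∣ s := by
      by_contra hs
      exact h2 ((hcop hs).dvd_of_dvd_mul_left h1)
    refine hgcd (dvd_trans ?_ hs)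
    obtain ⟨w, hw⟩ : (2 : ℤ) ∣ 1 + u := by omega
    have hw2 : ¬(2 : ℤ) ∣ w := by omega
    have hco : IsCoprime ((Int.gcd (1 + u) (2 ^ k) : ℕ) : ℤ) w :=
      IsCoprime.of_isCoprime_of_dvd_left (hcop hw2) hdvd_right
    nth_rewrite 2 [hw] at hdvd_left
    exact hco.dvd_of_dvd_mul_right hdvd_left
  · obtain ⟨w, hw⟩ : (2 : ℤ) ∣ u - 1 := by omega
    have hw2 : ¬(2 : ℤ) ∣ w := by omega
    have h2s : (2 : ℤ) ^ k ∣ 2 * s := by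
      refine (hcop hw2).dvd_of_dvd_mul_right ?_
      rw [hw] at h1
      rwa [mul_comm 2 s, mul_assoc]
    refine ⟨?_, h2s⟩
    obtain ⟨c, hck, hc⟩ := (Nat.dvd_prime_pow Nat.prime_two).1
      (by exact_mod_cast hdvd_right : Int.gcd (1 + u) (2 ^ k) ∣ 2 ^ k)
    rw [hc] at hgcd hdvd_left
    push_cast at hgcd hdvd_left
    obtain rfl | hlt := hck.eq_or_lt
    · rwa [add_comm]
    · exfalso
      refine hgcd ((mul_dvd_mul_iff_left (two_ne_zero (α := ℤ))).1 (dvd_trans ?_ h2s))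
      rw [← pow_succ']
      exact pow_dvd_pow 2 hlt

namespace IsCommonInvolution

variable {G : Type*} [Group G]

theorem of_isPGroup {y : G} (hG : IsPGroup 2 G) (hy : orderOf y = 2)
    (huniq : ∀ x : G, orderOf x = 2 → x = y) : IsCommonInvolution y := by
  refine ⟨hy, fun x hx => ?_⟩
  obtain ⟨k, hk⟩ := IsPGroup.iff_orderOf.1 hG x
  have hk0 : k ≠ 0 := by
    rintro rfl
    exact hx (orderOf_eq_one_iff.1 (by simpa using hk))
  obtain ⟨j, rfl⟩ := Nat.exists_eq_succ_of_ne_zero hk0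
  have h : orderOf (x ^ 2 ^ j) = 2 := by
    rw [orderOf_pow_of_dvd (by positivity) (hk ▸ pow_dvd_pow 2 j.le_succ), hk,
      Nat.pow_succ, Nat.mul_div_cancel_left _ (by positivity)]
  rw [← huniq _ h]
  exact Subgroup.npow_mem_zpowers x _

/-- If a prime `p` divides the order of `g`, some power of `g` generates a subgroup of order `p`,
which contains `y`; so `p = 2`. -/
theorem isPGroup [Finite G] {y : G} (hy : IsCommonInvolution y) : IsPGroup 2 G := by
  refine IsPGroup.iff_orderOf.2 fun g =>
    ⟨_, Nat.eq_prime_pow_of_unique_prime_dvd (orderOf_pos g).ne' fun {p} hp hpg => ?_⟩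
  have hord := orderOf_pow_orderOf_div (orderOf_pos g).ne' hpg
  have hne : g ^ (orderOf g / p) ≠ 1 := fun h => by
    rw [h, orderOf_one] at hord
    exact hp.one_lt.ne hord
  have h2 := orderOf_dvd_of_mem_zpowers (hy.2 _ hne)
  rw [hy.1, hord] at h2
  exact ((Nat.prime_dvd_prime_iff_eq Nat.prime_two hp).1 h2).symm

theorem eq_one_or_eq_of_sq_eq_one {y : G} (hy : IsCommonInvolution y) {x : G} (hx : x ^ 2 = 1) :
    x = 1 ∨ x = y :=
  or_iff_not_imp_left.2 fun h => hy.eq_of_orderOf_eq_two (orderOf_eq_prime hx h)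

theorem normal_zpowers {y : G} (hy : IsCommonInvolution y) : (Subgroup.zpowers y).Normal := by
  have hc (g : G) : g * y * g⁻¹ = y := by
    refine hy.eq_of_orderOf_eq_two (orderOf_eq_prime ?_ ?_)
    · rw [conj_pow, ← hy.1, pow_orderOf_eq_one, mul_one, mul_inv_cancel]
    · rw [Ne, conj_eq_one_iff]
      exact hy.ne_one
  refine ⟨fun n hn g => ?_⟩
  obtain ⟨k, rfl⟩ := hn
  simp only
  rw [← conj_zpow, hc]
  exact Subgroup.zpow_mem_zpowers y k

theorem exists_maximal_normal_zpowers [Finite G] {y : G} (hy : IsCommonInvolution y) :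
    ∃ a : G, a ≠ 1 ∧ (Subgroup.zpowers a).Normal ∧
      ∀ b : G, (Subgroup.zpowers b).Normal → orderOf b ≤ orderOf a := by
  obtain ⟨a, ha, hmax⟩ := Set.exists_max_image {a : G | (Subgroup.zpowers a).Normal} orderOf
    (Set.toFinite _) ⟨y, hy.normal_zpowers⟩
  refine ⟨a, ?_, ha, hmax⟩
  rintro rfl
  have := hmax y hy.normal_zpowers
  rw [hy.1, orderOf_one] at this
  omega

theorem mem_of_sq_eq_one {y : G} (hy : IsCommonInvolution y) {H : Subgroup G} (hH : y ∈ H)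
    {x : G} (hx : x ^ 2 = 1) : x ∈ H := by
  rcases hy.eq_one_or_eq_of_sq_eq_one hx with rfl | rfl
  · exact H.one_mem
  · exact hH

end IsCommonInvolution

/-- Conjugation on `N` fixes `1`, and `p` divides the order of `N`, so there is a second fixed
point. -/
theorem IsPGroup.exists_ne_one_mem_mem_center {G : Type*} [Group G] [Finite G] {p : ℕ}
    [Fact p.Prime] (hG : IsPGroup p G) (N : Subgroup G) [N.Normal] (hN : N ≠ ⊥) :
    ∃ x ∈ N, x ∈ Subgroup.center G ∧ x ≠ 1 := by
  have hG' : IsPGroup p (ConjAct G) := hG.of_equiv ConjAct.toConjAct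
  have : Nontrivial N := N.nontrivial_iff_ne_bot.2 hN
  have hdvd : p ∣ Nat.card N := by
    obtain ⟨k, hk, h⟩ := (hG.to_subgroup N).nontrivial_iff_card.1 this
    exact h ▸ dvd_pow_self p hk.ne'
  have hfix : (1 : N) ∈ MulAction.fixedPoints (ConjAct G) N := fun g => smul_one g
  obtain ⟨b, hb, hb1⟩ := hG'.exists_fixed_point_of_prime_dvd_card_of_fixed_point N hdvd hfix
  refine ⟨b, b.2, Subgroup.mem_center_iff.2 fun g => ?_, fun h => hb1 (Subtype.ext h.symm)⟩
  have h := congrArg Subtype.val (hb (ConjAct.toConjAct g))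
  rw [ConjAct.Subgroup.val_conj_smul, ConjAct.toConjAct_smul] at h
  rwa [mul_inv_eq_iff_eq_mul] at h

/-- In a finite `p`-group, a normal subgroup that is not contained in a normal subgroup `A` has an
element outside `A` that is central of order `p` modulo `A`. -/
theorem IsPGroup.exists_central_mod {G : Type*} [Group G] [Finite G] {p : ℕ} [Fact p.Prime]
    (hG : IsPGroup p G) (A C : Subgroup G) [A.Normal] [C.Normal] (hCA : ¬C ≤ A) :
    ∃ x ∈ C, x ∉ A ∧ x ^ p ∈ A ∧ ∀ g : G, g * x * g⁻¹ * x⁻¹ ∈ A := by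
  have hnorm : (C.map (QuotientGroup.mk' A)).Normal :=
    Subgroup.Normal.map ‹_› _ (QuotientGroup.mk'_surjective A)
  have hne : C.map (QuotientGroup.mk' A) ≠ ⊥ := by
    rwa [Ne, Subgroup.map_eq_bot_iff, QuotientGroup.ker_mk']
  have hQ : IsPGroup p (G ⧸ A) := hG.to_quotient A
  obtain ⟨q, hqC, hqZ, hq1⟩ := hQ.exists_ne_one_mem_mem_center _ hne
  obtain ⟨k, hk⟩ := IsPGroup.iff_orderOf.1 hQ q
  have hk0 : k ≠ 0 := by
    rintro rfl
    exact hq1 (orderOf_eq_one_iff.1 (by simpa using hk))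
  obtain ⟨j, rfl⟩ := Nat.exists_eq_succ_of_ne_zero hk0
  -- The power `q ^ p ^ j` of the central element `q` has order exactly `p`.
  have hr1 : q ^ p ^ j ≠ 1 := fun h => by
    have := orderOf_dvd_of_pow_eq_one h
    rw [hk, Nat.pow_dvd_pow_iff_le_right (Fact.out : p.Prime).one_lt] at this
    omega
  have hrp : (q ^ p ^ j) ^ p = 1 := by rw [← pow_mul, ← pow_succ, ← hk, pow_orderOf_eq_one]
  have hrZ : q ^ p ^ j ∈ Subgroup.center (G ⧸ A) := pow_mem hqZ _
  obtain ⟨x, hxC, hx⟩ := pow_mem hqC (p ^ j)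
  rw [← hx] at hr1 hrp hrZ
  refine ⟨x, hxC, fun h => hr1 ((QuotientGroup.eq_one_iff x).2 h), ?_, fun g => ?_⟩
  · rw [← QuotientGroup.eq_one_iff]
    exact hrp
  · rw [← QuotientGroup.eq_one_iff]
    have h := Subgroup.mem_center_iff.1 hrZ (g : G ⧸ A)
    simp only [QuotientGroup.coe_mk'] at h
    simp [h]

theorem conj_zpow_zpow {G : Type*} [Group G] {x b : G} {u : ℤ} (h : x * b * x⁻¹ = b ^ u) (i : ℤ) :
    x * b ^ i * x⁻¹ = b ^ (i * u) := by
  rw [← conj_zpow, h, ← zpow_mul, mul_comm]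

theorem commute_of_conj_eq_inv {G : Type*} [Group G] {x b : G} (hb : orderOf b ∣ 2)
    (hx : x * b * x⁻¹ = b⁻¹) :
    Commute x b := by
  have h : b⁻¹ = b := by
    rw [inv_eq_iff_mul_eq_one, ← sq]
    exact orderOf_dvd_iff_pow_eq_one.1 hb
  rw [h] at hx
  exact mul_inv_eq_iff_eq_mul.1 hx

namespace IsCommonInvolution

variable {G : Type*} [Group G] [Finite G] {y a : G}

/-- A normal cyclic subgroup of maximal order is self-centralizing. -/
theorem mem_zpowers_of_commute (hy : IsCommonInvolution y) (ha1 : a ≠ 1)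
    (ha : (Subgroup.zpowers a).Normal)
    (hmax : ∀ b : G, (Subgroup.zpowers b).Normal → orderOf b ≤ orderOf a) {x : G}
    (hx : Commute x a) : x ∈ Subgroup.zpowers a := by
  have hC : (Subgroup.centralizer (Subgroup.zpowers a : Set G)).Normal := inferInstance
  suffices h : Subgroup.centralizer (Subgroup.zpowers a : Set G) ≤ Subgroup.zpowers a by
    refine h (Subgroup.mem_centralizer_iff.2 ?_)
    rintro _ ⟨k, rfl⟩
    exact (hx.zpow_right k).symm
  by_contra hnot
  obtain ⟨x, hxC, hxA, ⟨s, hs⟩, hcent⟩ := hy.isPGroup.exists_central_mod _ _ hnot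
  have hcomm : Commute x a :=
    (Subgroup.mem_centralizer_iff.1 hxC a (Subgroup.mem_zpowers a)).symm
  simp only at hs
  -- For even `s` a translate of `x` squares to `1`, which puts `x` in ⟨a⟩. For odd `s` the square
  -- of `x` generates ⟨a⟩, so ⟨x⟩ is a larger cyclic subgroup, normal because `x` is central modulo
  -- ⟨a⟩.
  rcases Int.even_or_odd' s with ⟨r, rfl | rfl⟩
  · have hsq : (x * a ^ (-r)) ^ 2 = 1 := by
      rw [(hcomm.zpow_right (-r)).mul_pow, ← hs, ← zpow_natCast (a ^ (-r)), ← zpow_mul,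
        ← zpow_add, ← zpow_zero a]
      congr 1
      push_cast
      ring
    have h := hy.mem_of_sq_eq_one (hy.2 a ha1) hsq
    refine hxA ?_
    have h' := mul_mem h (Subgroup.zpow_mem_zpowers a r)
    rwa [mul_assoc, ← zpow_add, neg_add_cancel, zpow_zero, mul_one] at h'
  · obtain ⟨k, hk⟩ := IsPGroup.iff_orderOf.1 hy.isPGroup a
    have hcop : IsCoprime (2 * r + 1) ((2 : ℤ) ^ k) :=
      IsCoprime.pow_right ⟨1, -r, by ring⟩
    obtain ⟨u, v, huv⟩ := hcop
    have hax : a ∈ Subgroup.zpowers x := by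
      have : a = (x ^ 2) ^ u := by
        have hv : a ^ (v * 2 ^ k) = 1 := by
          rw [← orderOf_dvd_iff_zpow_eq_one, hk, Nat.cast_pow, Nat.cast_ofNat]
          exact dvd_mul_left _ _
        rw [← hs, ← zpow_mul, mul_comm _ u, ← mul_one (a ^ _), ← hv, ← zpow_add, huv, zpow_one]
      rw [this]
      exact zpow_mem (Subgroup.npow_mem_zpowers x 2) u
    have hle : Subgroup.zpowers a ≤ Subgroup.zpowers x := Subgroup.zpowers_le.2 hax
    have hnx : (Subgroup.zpowers x).Normal := by
      refine ⟨?_⟩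
      rintro _ ⟨k, rfl⟩ g
      simp only
      rw [← conj_zpow]
      refine zpow_mem ?_ k
      have := mul_mem (hle (hcent g)) (Subgroup.mem_zpowers x)
      rwa [inv_mul_cancel_right] at this
    refine hxA ?_
    rw [Subgroup.eq_of_le_of_card_ge hle (by simpa only [Nat.card_zpowers] using hmax x hnx)]
    exact Subgroup.mem_zpowers x

theorem conj_eq_inv_of_sq_mem (hy : IsCommonInvolution y) (ha1 : a ≠ 1)
    (ha : (Subgroup.zpowers a).Normal)
    (hself : ∀ x : G, Commute x a → x ∈ Subgroup.zpowers a) {x : G}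
    (hx : x ∉ Subgroup.zpowers a) (hx2 : x ^ 2 ∈ Subgroup.zpowers a) :
    x * a * x⁻¹ = a⁻¹ ∧ x ^ 2 = y := by
  obtain ⟨k, hk⟩ := IsPGroup.iff_orderOf.1 hy.isPGroup a
  obtain ⟨u, hu⟩ := ha.conj_mem a (Subgroup.mem_zpowers a) x
  obtain ⟨s, hs⟩ := hx2
  simp only at hu hs
  have hdvd (i : ℤ) : (2 : ℤ) ^ k ∣ i ↔ a ^ i = 1 := by
    rw [← orderOf_dvd_iff_zpow_eq_one, hk, Nat.cast_pow, Nat.cast_ofNat]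
  have h1 : (2 : ℤ) ^ k ∣ s * (u - 1) := by
    have := conj_zpow_zpow hu.symm s
    rw [hs] at this
    rw [hdvd, mul_sub, mul_one, zpow_sub, ← this, hs]
    group
  have h2 : ¬(2 : ℤ) ^ k ∣ u - 1 := by
    rw [hdvd, zpow_sub, zpow_one, mul_inv_eq_one]
    intro h
    rw [h] at hu
    exact hx (hself x (mul_inv_eq_iff_eq_mul.1 hu.symm))
  have h3 (i : ℤ) : ¬(2 : ℤ) ^ k ∣ i * (1 + u) + s := by
    rw [hdvd]
    intro h
    have hsq : (a ^ i * x) ^ 2 = 1 := by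
      rw [← h, mul_add, mul_one, zpow_add, zpow_add, ← conj_zpow_zpow hu.symm, hs]
      simp only [sq]
      group
    have h' := mul_mem (Subgroup.zpow_mem_zpowers a (-i))
      (hy.mem_of_sq_eq_one (hy.2 a ha1) hsq)
    rw [← mul_assoc, ← zpow_add, neg_add_cancel, zpow_zero, one_mul] at h'
    exact hx h'
  obtain ⟨hu1, hs2⟩ := two_pow_dvd_of_forall_not_dvd h1 h2 h3
  constructor
  · rw [← hu, eq_inv_iff_mul_eq_one, ← zpow_add_one, ← hdvd]
    exact hu1
  · refine (hy.eq_one_or_eq_of_sq_eq_one ?_).resolve_left fun h => ?_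
    · rw [← hs, ← zpow_natCast, ← zpow_mul, ← hdvd, mul_comm]
      exact hs2
    · refine h3 0 ?_
      rw [zero_mul, zero_add, hdvd, hs, h]

/-- Otherwise, by induction, `x ^ 2` inverts `a`. If `x` acts by the exponent `u`, then `u * u` is
-1 modulo the order of `a`, which is divisible by 4 since inversion is nontrivial; but -1 is not a
square mod 4. -/
theorem sq_mem_zpowers (hy : IsCommonInvolution y) (ha1 : a ≠ 1)
    (ha : (Subgroup.zpowers a).Normal)
    (hself : ∀ x : G, Commute x a → x ∈ Subgroup.zpowers a) (m : ℕ) (x : G)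
    (hx : x ∉ Subgroup.zpowers a) (hm : x ^ 2 ^ m ∈ Subgroup.zpowers a) :
    x ^ 2 ∈ Subgroup.zpowers a := by
  induction m generalizing x with
  | zero => exact absurd (by simpa using hm) hx
  | succ m ih =>
    by_contra hw
    rw [pow_succ', pow_mul] at hm
    have hinv := (hy.conj_eq_inv_of_sq_mem ha1 ha hself hw (ih _ hw hm)).1
    obtain ⟨k, hk⟩ := IsPGroup.iff_orderOf.1 hy.isPGroup a
    have hk2 : 2 ≤ k := by
      by_contra hlt
      refine hw (hself _ (commute_of_conj_eq_inv ?_ hinv))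
      rw [hk]
      exact pow_dvd_pow 2 (by omega : k ≤ 1)
    obtain ⟨u, hu⟩ := ha.conj_mem a (Subgroup.mem_zpowers a) x
    simp only at hu
    have h2 : x ^ 2 * a * (x ^ 2)⁻¹ = a ^ (u * u) := by
      rw [← conj_zpow_zpow hu.symm u, hu]
      simp only [sq]
      group
    rw [hinv, inv_eq_iff_mul_eq_one, ← zpow_one_add, ← orderOf_dvd_iff_zpow_eq_one, hk] at h2
    have h4 : (4 : ℤ) ∣ 1 + u * u := by
      refine dvd_trans ?_ h2
      exact_mod_cast pow_dvd_pow 2 hk2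
    rcases Int.even_or_odd' u with ⟨r, rfl | rfl⟩
    · ring_nf at h4
      omega
    · ring_nf at h4
      omega

end IsCommonInvolution

section Quaternion

variable {G : Type*} [Group G]

/-- A group with a cyclic subgroup of order `2 * n` and index two, inverted by an element `x` outside
it with `x ^ 2 = a ^ n`, is a generalized quaternion group. -/
theorem nonempty_mulEquiv_quaternionGroup {n : ℕ} {a x : G} (ha : orderOf a = 2 * n)
    (hx2 : x ^ 2 = a ^ n) (hinv : x * a * x⁻¹ = a⁻¹) (hx : x ∉ Subgroup.zpowers a)
    (hidx : ∀ g, g ∈ Subgroup.zpowers a ∨ x⁻¹ * g ∈ Subgroup.zpowers a) :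
    Nonempty (G ≃* QuaternionGroup n) := by
  -- `hp` makes this independent of the chosen integer representative, so all exponent computations
  -- take place in ℤ.
  let p : ZMod (2 * n) → G := fun i => a ^ (i.cast : ℤ)
  have hp (m : ℤ) : p m = a ^ m := by
    rw [← mul_inv_eq_one, ← zpow_neg, ← zpow_add, ← orderOf_dvd_iff_zpow_eq_one, ha,
      ← ZMod.intCast_zmod_eq_zero_iff_dvd]
    simp
  have hcomm (i : ℤ) : a ^ i * x = x * a ^ (-i) := by
    have h := conj_zpow (i := -i) (a := x) (b := a)
    rw [hinv, inv_zpow, zpow_neg, inv_inv] at h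
    rw [h, zpow_neg]
    group
  let f : QuaternionGroup n → G := fun q => match q with
    | .a i => p i
    | .xa i => x * p i
  let F : QuaternionGroup n →* G := MonoidHom.mk' f (by
    rintro (i | i) (j | j) <;> obtain ⟨i, rfl⟩ := ZMod.intCast_surjective i <;>
      obtain ⟨j, rfl⟩ := ZMod.intCast_surjective j
    · simp only [QuaternionGroup.a_mul_a, f, ← Int.cast_add, hp, zpow_add]
    · simp only [QuaternionGroup.a_mul_xa, f, ← Int.cast_sub, hp]
      rw [← mul_assoc, hcomm, mul_assoc, ← zpow_add, neg_add_eq_sub]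
    · simp only [QuaternionGroup.xa_mul_a, f, ← Int.cast_add, hp, zpow_add, mul_assoc]
    · simp only [QuaternionGroup.xa_mul_xa, f]
      rw [← Int.cast_natCast n, ← Int.cast_add, ← Int.cast_sub, hp, hp, hp, mul_assoc,
        ← mul_assoc (a ^ i), hcomm, mul_assoc x, ← mul_assoc, ← sq, hx2, ← zpow_add,
        ← zpow_natCast, ← zpow_add]
      congr 1
      ring)
  refine ⟨(MulEquiv.ofBijective F ⟨(injective_iff_map_eq_one F).2 ?_, fun g => ?_⟩).symm⟩
  · rintro (i | i) h <;> obtain ⟨i, rfl⟩ := ZMod.intCast_surjective i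
    · change p i = 1 at h
      rw [hp, ← orderOf_dvd_iff_zpow_eq_one, ha, ← ZMod.intCast_zmod_eq_zero_iff_dvd] at h
      rw [h]
      rfl
    · change x * p i = 1 at h
      rw [hp, mul_eq_one_iff_eq_inv] at h
      exact absurd (h ▸ inv_mem (Subgroup.zpow_mem_zpowers a i)) hx
  · rcases hidx g with ⟨i, hi⟩ | ⟨i, hi⟩
    · exact ⟨.a i, (hp i).trans hi⟩
    · refine ⟨.xa i, ?_⟩
      change x * p i = g
      rw [hp]
      exact mul_eq_of_eq_inv_mul hi

end Quaternion

/-- A finite group with an involution in every nontrivial cyclic subgroup is a cyclic or a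
generalized quaternion `2`-group. -/
theorem IsCommonInvolution.cyclic_or_quaternion {G : Type*} [Group G] [Finite G] {y : G}
    (hy : IsCommonInvolution y) :
    (∃ k : ℕ, 1 ≤ k ∧ Nonempty (G ≃* Multiplicative (ZMod (2 ^ k)))) ∨
      ∃ t : ℕ, 1 ≤ t ∧ Nonempty (G ≃* QuaternionGroup (2 ^ t)) := by
  obtain ⟨a, ha1, ha, hmax⟩ := hy.exists_maximal_normal_zpowers
  have hself (x : G) (hx : Commute x a) := hy.mem_zpowers_of_commute ha1 ha hmax hx
  obtain ⟨k, hk⟩ := IsPGroup.iff_orderOf.1 hy.isPGroup a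
  have hk1 : 1 ≤ k := by
    rw [Nat.one_le_iff_ne_zero]
    rintro rfl
    exact ha1 (orderOf_eq_one_iff.1 (by simpa using hk))
  by_cases hall : ∀ x, x ∈ Subgroup.zpowers a
  · left
    have hcard : Nat.card G = 2 ^ k := (orderOf_eq_card_of_forall_mem_zpowers hall).symm.trans hk
    have hcyc : IsCyclic G := ⟨a, hall⟩
    exact ⟨k, hk1, ⟨hcard ▸ (zmodCyclicMulEquiv hcyc).symm⟩⟩
  · right
    push Not at hall
    obtain ⟨x, hx⟩ := hall
    have hmain (g : G) (hg : g ∉ Subgroup.zpowers a) : g * a * g⁻¹ = a⁻¹ ∧ g ^ 2 = y := by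
      obtain ⟨m, hm⟩ := hy.isPGroup g
      exact hy.conj_eq_inv_of_sq_mem ha1 ha hself hg
        (hy.sq_mem_zpowers ha1 ha hself m g hg (hm ▸ one_mem _))
    have hinv := (hmain x hx).1
    have hk2 : 2 ≤ k := by
      by_contra hlt
      refine hx (hself _ (commute_of_conj_eq_inv ?_ hinv))
      rw [hk]
      exact pow_dvd_pow 2 (by omega : k ≤ 1)
    obtain ⟨t, rfl⟩ : ∃ t, k = t + 1 := ⟨k - 1, by omega⟩
    refine ⟨t, by omega, nonempty_mulEquiv_quaternionGroup (hk.trans (pow_succ' 2 t)) ?_ hinv hx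
      fun g => ?_⟩
    -- `a ^ 2 ^ t` is the involution of ⟨a⟩, hence equal to `y`.
    · rw [(hmain x hx).2]
      refine ((hy.eq_one_or_eq_of_sq_eq_one ?_).resolve_left fun h => ?_).symm
      · rw [← pow_mul, ← pow_succ, ← hk, pow_orderOf_eq_one]
      · have := orderOf_dvd_of_pow_eq_one h
        rw [hk, Nat.pow_dvd_pow_iff_le_right (by norm_num)] at this
        omega
    · by_cases hg : g ∈ Subgroup.zpowers a
      · exact Or.inl hg
      -- `x` and `g` both invert `a`, so `x⁻¹ * g` centralizes it: ⟨a⟩ has index two.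
      · refine Or.inr (hself _ (mul_inv_eq_iff_eq_mul.1 ?_))
        have h1 : x⁻¹ * a⁻¹ * x = a := by
          rw [← hinv]
          group
        calc x⁻¹ * g * a * (x⁻¹ * g)⁻¹ = x⁻¹ * (g * a * g⁻¹) * x := by group
          _ = a := by rw [(hmain g hg).1, h1]

/-! ### Invariance under isomorphism, and the cyclic and quaternion 2-groups -/

section Transfer

variable {G H : Type*} [Group G] [Group H]

theorem MulEquiv.elementOrders_eq (e : G ≃* H) : elementOrders G = elementOrders H := by
  ext m
  constructor
  · rintro ⟨g, rfl⟩
    exact ⟨e g, e.orderOf_eq g⟩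
  · rintro ⟨h, rfl⟩
    exact ⟨e.symm h, e.symm.orderOf_eq h⟩

theorem MulEquiv.maxOmegaElementOrder_eq (e : G ≃* H) :
    maxOmegaElementOrder G = maxOmegaElementOrder H := by
  rw [maxOmegaElementOrder, e.elementOrders_eq, maxOmegaElementOrder]

theorem MulEquiv.exists_isCommonInvolution (e : G ≃* H) {y : H} (hy : IsCommonInvolution y) :
    ∃ x : G, IsCommonInvolution x := by
  refine ⟨e.symm y, (e.symm.orderOf_eq y).trans hy.1, fun x hx => ?_⟩
  obtain ⟨k, hk⟩ := hy.2 (e x) (by simpa using hx)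
  refine ⟨k, e.injective ?_⟩
  simpa using hk

theorem maxOmegaElementOrder_eq_of_orderOf_dvd [Finite G] {m : ℕ} (hm : m ≠ 0)
    (hdvd : ∀ g : G, orderOf g ∣ m) {g : G} (hg : orderOf g = m) :
    maxOmegaElementOrder G = cardFactors m := by
  refine le_antisymm ?_ (hg ▸ cardFactors_orderOf_le g)
  obtain ⟨x, hx⟩ := exists_cardFactors_orderOf_eq G
  rw [← hx]
  by_cases h : orderOf x = m
  · rw [h]
  · exact (cardFactors_lt_of_dvd hm (hdvd x) h).le

end Transfer

section TwoGroups

theorem orderOf_pow_eq_two {G : Type*} [Group G] {g : G} {m : ℕ} (hm : 0 < m)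
    (hg : orderOf g = 2 * m) : orderOf (g ^ m) = 2 := by
  rw [orderOf_pow_of_dvd hm.ne' (Dvd.intro_left 2 hg.symm), hg, Nat.mul_div_cancel _ hm]

theorem eq_pow_of_mem_zpowers_of_orderOf_eq_two {G : Type*} [Group G] {g x : G} {m : ℕ}
    (hm : 0 < m) (hg : orderOf g = 2 * m) (hx : x ∈ Subgroup.zpowers g) (hx2 : orderOf x = 2) :
    x = g ^ m := by
  have hx1 : x ≠ 1 := by
    rintro rfl
    simp at hx2
  refine eq_of_mem_zpowers_of_orderOf_eq_two (orderOf_pow_eq_two hm hg) hx1 ?_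
  have hf : IsOfFinOrder g := orderOf_pos_iff.1 (by omega)
  obtain ⟨i, rfl⟩ := hf.mem_powers_iff_mem_zpowers.2 hx
  simp only at hx2
  have h := pow_orderOf_eq_one (g ^ i)
  rw [hx2, ← pow_mul, ← orderOf_dvd_iff_pow_eq_one, hg, mul_comm i,
    Nat.mul_dvd_mul_iff_left two_pos] at h
  obtain ⟨c, rfl⟩ := h
  simp only [pow_mul]
  exact Subgroup.npow_mem_zpowers _ c

theorem orderOf_ofAdd_one_zmod (n : ℕ) : orderOf (Multiplicative.ofAdd (1 : ZMod n)) = n := by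
  rw [orderOf_ofAdd_eq_addOrderOf, ZMod.addOrderOf_one]

theorem mem_zpowers_ofAdd_one_zmod {n : ℕ} (x : Multiplicative (ZMod n)) :
    x ∈ Subgroup.zpowers (Multiplicative.ofAdd (1 : ZMod n)) := by
  obtain ⟨m, hm⟩ := ZMod.intCast_surjective x.toAdd
  refine ⟨m, ?_⟩
  simp only
  rw [← ofAdd_zsmul, zsmul_one, hm, ofAdd_toAdd]

theorem exists_isCommonInvolution_zmod {k : ℕ} (hk : 1 ≤ k) :
    ∃ y : Multiplicative (ZMod (2 ^ k)), IsCommonInvolution y := by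
  obtain ⟨j, rfl⟩ : ∃ j, k = j + 1 := ⟨k - 1, by omega⟩
  have hP : IsPGroup 2 (Multiplicative (ZMod (2 ^ (j + 1)))) :=
    IsPGroup.of_card (n := j + 1) (by simp)
  have hg := (orderOf_ofAdd_one_zmod (2 ^ (j + 1))).trans (pow_succ' 2 j)
  have hj : 0 < 2 ^ j := by positivity
  exact ⟨_, .of_isPGroup hP (orderOf_pow_eq_two hj hg) fun x hx =>
    eq_pow_of_mem_zpowers_of_orderOf_eq_two hj hg (mem_zpowers_ofAdd_one_zmod x) hx⟩

theorem maxOmegaElementOrder_zmod (k : ℕ) :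
    maxOmegaElementOrder (Multiplicative (ZMod (2 ^ k))) = k := by
  rw [maxOmegaElementOrder_eq_of_orderOf_dvd (m := 2 ^ k)
    (g := Multiplicative.ofAdd (1 : ZMod (2 ^ k))) (by positivity) ?_ ?_,
    ArithmeticFunction.cardFactors_apply_prime_pow Nat.prime_two]
  · intro g
    simpa using orderOf_dvd_natCard g
  · exact orderOf_ofAdd_one_zmod _

theorem natCard_quaternionGroup (t : ℕ) : Nat.card (QuaternionGroup (2 ^ t)) = 2 ^ (t + 2) := by
  rw [Nat.card_eq_fintype_card, QuaternionGroup.card]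
  ring

/-- The elements `xa i` have order 4, so every involution lies in the cyclic group generated by `a
1`. -/
theorem exists_isCommonInvolution_quaternionGroup (t : ℕ) :
    ∃ y : QuaternionGroup (2 ^ t), IsCommonInvolution y := by
  have hP : IsPGroup 2 (QuaternionGroup (2 ^ t)) := IsPGroup.of_card (natCard_quaternionGroup t)
  have ha1 : orderOf (QuaternionGroup.a 1 : QuaternionGroup (2 ^ t)) = 2 * 2 ^ t :=
    QuaternionGroup.orderOf_a_one
  have ht : 0 < 2 ^ t := by positivity
  refine ⟨_, .of_isPGroup hP (orderOf_pow_eq_two ht ha1) fun x hx => ?_⟩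
  cases x with
  | xa i =>
    rw [QuaternionGroup.orderOf_xa] at hx
    omega
  | a i =>
    refine eq_pow_of_mem_zpowers_of_orderOf_eq_two ht ha1 ⟨i.val, ?_⟩ hx
    exact (zpow_natCast _ _).trans
      ((QuaternionGroup.a_one_pow _).trans (congrArg _ (ZMod.natCast_zmod_val i)))

theorem maxOmegaElementOrder_quaternionGroup {t : ℕ} (ht : 1 ≤ t) :
    maxOmegaElementOrder (QuaternionGroup (2 ^ t)) = t + 1 := by
  rw [maxOmegaElementOrder_eq_of_orderOf_dvd (m := 2 ^ (t + 1)) (g := QuaternionGroup.a 1)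
    (by positivity) ?_ ?_, ArithmeticFunction.cardFactors_apply_prime_pow Nat.prime_two]
  · rintro (i | i)
    · rw [QuaternionGroup.orderOf_a, pow_succ']
      exact Nat.div_dvd_of_dvd (Nat.gcd_dvd_left _ _)
    · rw [QuaternionGroup.orderOf_xa]
      -- This needs `1 ≤ t`: for `t = 0` the elements of order 4 lie outside ⟨a 1⟩, which has order
      -- 2.
      exact pow_dvd_pow 2 (by omega : 2 ≤ t + 1)
  · rw [QuaternionGroup.orderOf_a_one, pow_succ']

end TwoGroups

theorem theorem5p1 (G : Type*) [Group G] [Finite G] (n : ℕ) (hn : Nat.card G = n) :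
    (∀ k : ℕ, 1 ≤ k → Nonempty (G ≃* Multiplicative (ZMod (2 ^ k))) →
      ((reducedPowerGraph G).strongMetricDim : ℤ) = 2 ^ k - k) ∧
    (∀ t : ℕ, 1 ≤ t → Nonempty (G ≃* QuaternionGroup (2 ^ t)) →
      ((reducedPowerGraph G).strongMetricDim : ℤ) = 2 ^ (t + 2) - t - 1) ∧
    ((¬ ∃ k : ℕ, 1 ≤ k ∧ Nonempty (G ≃* Multiplicative (ZMod (2 ^ k)))) →
      (¬ ∃ t : ℕ, 1 ≤ t ∧ Nonempty (G ≃* QuaternionGroup (2 ^ t))) →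
      ((reducedPowerGraph G).strongMetricDim : ℤ) = n - maxOmegaElementOrder G - 1) := by
  refine ⟨?_, ?_, ?_⟩
  · rintro k hk ⟨e⟩
    obtain ⟨y, hy⟩ := exists_isCommonInvolution_zmod hk
    obtain ⟨x, hx⟩ := e.exists_isCommonInvolution hy
    have h := strongMetricDim_of_isCommonInvolution hx
    rw [e.maxOmegaElementOrder_eq, maxOmegaElementOrder_zmod, Nat.card_congr e.toEquiv,
      Nat.card_eq_fintype_card, Fintype.card_multiplicative, ZMod.card] at h
    rw [eq_sub_iff_add_eq]
    exact_mod_cast h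
  · rintro t ht ⟨e⟩
    obtain ⟨y, hy⟩ := exists_isCommonInvolution_quaternionGroup t
    obtain ⟨x, hx⟩ := e.exists_isCommonInvolution hy
    have h := strongMetricDim_of_isCommonInvolution hx
    rw [e.maxOmegaElementOrder_eq, maxOmegaElementOrder_quaternionGroup ht,
      Nat.card_congr e.toEquiv, natCard_quaternionGroup] at h
    rw [sub_sub, eq_sub_iff_add_eq]
    exact_mod_cast h
  · intro hcyc hquat
    have hnot : ¬∃ y : G, IsCommonInvolution y := by
      rintro ⟨y, hy⟩
      exact hy.cyclic_or_quaternion.elim hcyc hquat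
    have h := strongMetricDim_of_not_exists_isCommonInvolution hnot
    rw [hn] at h
    rw [sub_sub, eq_sub_iff_add_eq]
    exact_mod_cast h
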